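/- Let $\mathfrak H=\{z=x+iy: y>0\}$, $q=e^{2\pi i z}$ and $\mathbb L=\log|q|=i\pi(z-\bar z)=-2\pi y$. For $r,s\in\mathbb Z$ let $\mathcal M_{r,s}$ be the complex vector space of real analytic functions $f:\mathfrak H\to\mathbb C$ such that $$f(\gamma z)=(cz+d)^r(c\bar z+d)^s f(z)\qquad\text{for all }\gamma=\begin{pmatrix}a&b\\c&d\end{pmatrix}\in \mathrm{SL}_2(\mathbb Z),\ z\in\mathfrak H,$$ and which admit an expansion in $\mathbb C[[q,\bar q]][\mathbb L^{\pm1}]$ near the cusp, that is, for some $N\in\mathbb N$ and coefficients $a^{(k)}_{m,n}\in\mathbb C$, $$f=\sum_{k=-N}^{N}\mathbb L^k\sum_{m,n\ge 0}a^{(k)}_{m,n}\,q^m\bar q^n ,$$ where the double series converge absolutely for all $z$ with sufficiently large imaginary part. Let $\mathcal M=\bigoplus_{r,s\in\mathbb Z}\mathcal M_{r,s}$, and let $\partial$ be the linear operator on $\mathcal M$, of bidegree $(1,-1)$, which acts on the component $\mathcal M_{r,s}$ by $$\partial_r=(z-\bar z)\frac{\partial}{\partial z}+r .$$ For $n\in\mathbb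 Z$ let $S_n$ be the space of holomorphic cusp forms of weight $n$ for $\mathrm{SL}_2(\mathbb Z)$. A form $f\in S_n$ has weights $(n,0)$, and for $k\in\mathbb Z$ the function $\mathbb L^k f$ has weights $(n-k,-k)$. Then for every $n\in\mathbb Z$, every non-zero cusp form $f\in S_n$ and every $k\in\mathbb Z$, the equation $$\partial F=\mathbb L^k f$$ has no solution $F\in\mathcal M$. -/

import Mathlib

open UpperHalfPlane
open scoped MatrixGroups ComplexConjugate DirectSum

noncomputable section

namespace RealAnalyticModular

/-- `q = exp (2 π i z)`. -/
def q (z : ℍ) : ℂ := Complex.exp (2 * Real.pi * Complex.I * z)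

/-- `𝕃 = log |q| = i π (z - conj z) = -2 π y`. -/
def L (z : ℍ) : ℂ := ((-2 * Real.pi * z.im : ℝ) : ℂ)

theorem L_eq (z : ℍ) : L z = Complex.I * Real.pi * ((z : ℂ) - conj (z : ℂ)) := by
  rw [L, Complex.sub_conj, UpperHalfPlane.coe_im]
  push_cast
  linear_combination (-2 * (Real.pi : ℂ) * (z.im : ℂ)) * Complex.I_sq

theorem L_eq_log (z : ℍ) : L z = ((Real.log ‖q z‖ : ℝ) : ℂ) := by
  rw [L, q, Complex.norm_exp, Real.log_exp]
  congr 1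
  simp

/-- `f : ℍ → ℂ` is real analytic on the upper half plane. -/
def IsRealAnalytic (f : ℍ → ℂ) : Prop :=
  AnalyticOnNhd ℝ (fun w : ℂ => f (ofComplex w)) {w : ℂ | 0 < w.im}

/-- `f (γ z) = (c z + d) ^ r * (c (conj z) + d) ^ s * f z` for all
`γ = (a, b; c, d)` in `SL₂(ℤ)`. -/
def IsModularOfWeights (r s : ℤ) (f : ℍ → ℂ) : Prop :=
  ∀ (γ : SL(2, ℤ)) (z : ℍ),
    f (γ • z) = (((γ 1 0 : ℤ) : ℂ) * (z : ℂ) + ((γ 1 1 : ℤ) : ℂ)) ^ r *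
      (((γ 1 0 : ℤ) : ℂ) * conj (z : ℂ) + ((γ 1 1 : ℤ) : ℂ)) ^ s * f z

/-- The term `a_{m,n} q ^ m (conj q) ^ n` of a double power series, at `p = (m, n)`. -/
def expTerm (a : ℕ × ℕ → ℂ) (z : ℍ) (p : ℕ × ℕ) : ℂ :=
  a p * q z ^ p.1 * conj (q z) ^ p.2

/-- `f` is given near the cusp by an element of `ℂ[[q, conj q]][𝕃, 𝕃⁻¹]`, that is,
`f = ∑_{k = -N}^{N} 𝕃 ^ k ∑_{m, n ≥ 0} a k (m, n) q ^ m (conj q) ^ n`,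
where the double series converge absolutely for all `z` of large enough imaginary part. -/
def HasExpansion (f : ℍ → ℂ) : Prop :=
  ∃ (N : ℕ) (a : ℤ → ℕ × ℕ → ℂ) (Y : ℝ), ∀ z : ℍ, Y < z.im →
    (∀ k ∈ Finset.Icc (-N : ℤ) N, Summable (expTerm (a k) z)) ∧
      f z = ∑ k ∈ Finset.Icc (-N : ℤ) N, L z ^ k * ∑' p : ℕ × ℕ, expTerm (a k) z p

theorem expTerm_zero (z : ℍ) : expTerm 0 z = 0 := by
  funext p
  simp [expTerm]

theorem hasExpansion_zero : HasExpansion 0 := by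
  refine ⟨0, 0, 0, fun z _ => ⟨fun k _ => ?_, ?_⟩⟩
  · rw [Pi.zero_apply, expTerm_zero]
    exact summable_zero
  · simp [expTerm_zero]

theorem HasExpansion.smul {f : ℍ → ℂ} (c : ℂ) (hf : HasExpansion f) : HasExpansion (c • f) := by
  obtain ⟨N, a, Y, h⟩ := hf
  have e : ∀ k z, expTerm ((c • a) k) z = fun p => c * expTerm (a k) z p := by
    intro k z
    funext p
    simp [expTerm, mul_assoc]
  refine ⟨N, c • a, Y, fun z hz => ⟨fun k hk => ?_, ?_⟩⟩
  · rw [e]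
    exact ((h z hz).1 k hk).mul_left c
  · rw [Pi.smul_apply, smul_eq_mul, (h z hz).2, Finset.mul_sum]
    refine Finset.sum_congr rfl fun k _ => ?_
    rw [e, tsum_mul_left]
    ring

/-- The order of the expansion may be enlarged, with coefficients extended by zero. -/
theorem HasExpansion.pad {f : ℍ → ℂ} (hf : HasExpansion f) :
    ∃ N₀ : ℕ, ∀ N, N₀ ≤ N → ∃ (a : ℤ → ℕ × ℕ → ℂ) (Y : ℝ), ∀ z : ℍ, Y < z.im →
      (∀ k, Summable (expTerm (a k) z)) ∧
        f z = ∑ k ∈ Finset.Icc (-N : ℤ) N, L z ^ k * ∑' p : ℕ × ℕ, expTerm (a k) z p := by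
  obtain ⟨N₀, a, Y, h⟩ := hf
  refine ⟨N₀, fun N hN => ⟨fun k => if k ∈ Finset.Icc (-N₀ : ℤ) N₀ then a k else 0, Y,
    fun z hz => ⟨fun k => ?_, ?_⟩⟩⟩
  · by_cases hk : k ∈ Finset.Icc (-N₀ : ℤ) N₀
    · simp only [hk, if_true]
      exact (h z hz).1 k hk
    · simp only [hk, if_false]
      exact (expTerm_zero z).symm ▸ summable_zero
  · rw [(h z hz).2]
    have hsub : Finset.Icc (-N₀ : ℤ) N₀ ⊆ Finset.Icc (-N : ℤ) N :=
      Finset.Icc_subset_Icc (by omega) (by omega)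
    rw [← Finset.sum_subset hsub]
    · exact Finset.sum_congr rfl fun k hk => by simp only [hk, if_true]
    · intro k _ hk
      simp [hk, expTerm_zero]

theorem HasExpansion.add {f g : ℍ → ℂ} (hf : HasExpansion f) (hg : HasExpansion g) :
    HasExpansion (f + g) := by
  obtain ⟨N₁, h₁⟩ := hf.pad
  obtain ⟨N₂, h₂⟩ := hg.pad
  obtain ⟨a, Y₁, ha⟩ := h₁ (max N₁ N₂) (le_max_left _ _)
  obtain ⟨b, Y₂, hb⟩ := h₂ (max N₁ N₂) (le_max_right _ _)
  have e : ∀ k z, expTerm ((a + b) k) z = fun p => expTerm (a k) z p + expTerm (b k) z p := by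
    intro k z
    funext p
    simp [expTerm, add_mul]
  refine ⟨max N₁ N₂, a + b, max Y₁ Y₂, fun z hz => ?_⟩
  obtain ⟨sa, ea⟩ := ha z (lt_of_le_of_lt (le_max_left _ _) hz)
  obtain ⟨sb, eb⟩ := hb z (lt_of_le_of_lt (le_max_right _ _) hz)
  refine ⟨fun k _ => ?_, ?_⟩
  · rw [e]
    exact (sa k).add (sb k)
  · rw [Pi.add_apply, ea, eb, ← Finset.sum_add_distrib]
    refine Finset.sum_congr rfl fun k _ => ?_
    rw [e, (sa k).tsum_add (sb k), mul_add]

/-- The space `𝓜_{r,s}` of real analytic functions on `ℍ` which are modular of weights `(r, s)`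
and admit an expansion in `ℂ[[q, conj q]][𝕃, 𝕃⁻¹]`. -/
def Mrs (r s : ℤ) : Submodule ℂ (ℍ → ℂ) where
  carrier := {f | IsRealAnalytic f ∧ IsModularOfWeights r s f ∧ HasExpansion f}
  zero_mem' := ⟨fun _ _ => analyticAt_const, fun _ _ => by simp, hasExpansion_zero⟩
  add_mem' := fun {f g} hf hg =>
    ⟨fun w hw => (hf.1 w hw).add (hg.1 w hw),
      fun γ z => by simp only [Pi.add_apply, hf.2.1 γ z, hg.2.1 γ z]; ring,
      hf.2.2.add hg.2.2⟩
  smul_mem' := fun c f hf =>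
    ⟨fun w hw => analyticAt_const.mul (hf.1 w hw),
      fun γ z => by simp only [Pi.smul_apply, smul_eq_mul, hf.2.1 γ z]; ring,
      hf.2.2.smul c⟩

/-- The bigraded space `𝓜 = ⨁_{r,s} 𝓜_{r,s}`. -/
abbrev M : Type := ⨁ p : ℤ × ℤ, Mrs p.1 p.2

/-- The Wirtinger derivative `∂f/∂z = (∂f/∂x - i ∂f/∂y) / 2` of a function on `ℍ`. -/
def wirtinger (f : ℍ → ℂ) (z : ℍ) : ℂ :=
  (fderiv ℝ (fun w : ℂ => f (ofComplex w)) (z : ℂ) 1 -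
    Complex.I * fderiv ℝ (fun w : ℂ => f (ofComplex w)) (z : ℂ) Complex.I) / 2

/-- The operator `∂_r = (z - conj z) ∂/∂z + r`. -/
def partialOp (r : ℤ) (f : ℍ → ℂ) (z : ℍ) : ℂ :=
  ((z : ℂ) - conj (z : ℂ)) * wirtinger f z + (r : ℂ) * f z

/-- The operator `∂` on `𝓜`, of bidegree `(1, -1)`, which acts on the component of weights
`(r, s)` by `∂_r`. The value is written as the family of its bihomogeneous components:
the component of weights `(r, s)` of `∂F` is `∂_{r-1}` of that of weights `(r - 1, s + 1)` of `F`. -/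
def del (F : M) : ℤ × ℤ → ℍ → ℂ :=
  fun p => partialOp (p.1 - 1) (F (p.1 - 1, p.2 + 1) : ℍ → ℂ)

/-- The element `𝕃 ^ k f` for `f` of weights `(n, 0)`, as the family of its bihomogeneous
components: it is concentrated in weights `(n - k, -k)`, because `𝕃` has weights `(-1, -1)`. -/
def LpowMul (k n : ℤ) (f : ℍ → ℂ) : ℤ × ℤ → ℍ → ℂ :=
  Pi.single (n - k, -k) (fun z => L z ^ k * f z)

end RealAnalyticModular

end

noncomputable section

namespace RealAnalyticModular

open MeasureTheory Set Filter Topology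

/-! Only one component of `F` matters: its weights `(r, s)` satisfy `s + n = r + 2`, and `∂_r F = 𝕃
^ k f`. Pair it with `f` in the Petersson manner. The form `U d(conj z)` with `U = y ^ r F conj f`
is then `SL₂(ℤ)`-invariant, and since `conj f` is antiholomorphic, `∂U/∂z` is a constant multiple of
`y ^ (r - 1) (∂_r F) conj f`, hence of `y ^ (r - 1 + k) |f| ^ 2`.

Apply Stokes' theorem to a truncated fundamental domain (`integral_wirt_fundamental_domain`). The
identified edges cancel, so up to a nonzero constant the truncated norm of `f` is an integral over
the upper edge (`integral_normDensity_eq_edge`). As the edge rises this integral tends to zero,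
because `F` grows polynomially while `f` decays exponentially (`pairing_tendsto_zero`). But the norm
is positive and does not decrease (`integral_normDensity_pos`), a contradiction.

Truncating by a translate of the unit arc instead of a horizontal line makes the domain the image of
a rectangle, where the divergence theorem applies directly. -/

/-! ### Stokes' theorem on the truncated fundamental domain -/

/-- Coordinates `(θ, t) ↦ sin θ + i (cos θ + t)` on the strip above the unit circle. -/
def arcCoord (p : ℝ × ℝ) : ℂ := Complex.I * (Complex.exp (-(p.1 : ℂ) * Complex.I) + (p.2 : ℂ))

theorem arcCoord_re (p : ℝ × ℝ) : (arcCoord p).re = Real.sin p.1 := by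
  simp [arcCoord, Complex.exp_im]

theorem arcCoord_im (p : ℝ × ℝ) : (arcCoord p).im = Real.cos p.1 + p.2 := by
  simp [arcCoord, Complex.exp_re]

theorem continuous_arcCoord : Continuous arcCoord := by
  unfold arcCoord
  fun_prop

theorem hasFDerivAt_arcCoord (p : ℝ × ℝ) :
    ∃ A : ℝ × ℝ →L[ℝ] ℂ, HasFDerivAt arcCoord A p ∧
      A (1, 0) = Complex.exp (-(p.1 : ℂ) * Complex.I) ∧ A (0, 1) = Complex.I := by
  have h1 : HasFDerivAt (fun p : ℝ × ℝ => (p.1 : ℂ))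
      (Complex.ofRealCLM.comp (ContinuousLinearMap.fst ℝ ℝ ℝ)) p :=
    Complex.ofRealCLM.hasFDerivAt.comp p hasFDerivAt_fst
  have h2 : HasFDerivAt (fun p : ℝ × ℝ => (p.2 : ℂ))
      (Complex.ofRealCLM.comp (ContinuousLinearMap.snd ℝ ℝ ℝ)) p :=
    Complex.ofRealCLM.hasFDerivAt.comp p hasFDerivAt_snd
  have h3 := ((h1.neg.mul_const Complex.I).cexp.add h2).const_mul Complex.I
  refine ⟨_, h3, ?_, ?_⟩
  · simp only [smul_apply, add_apply,
      neg_apply, ContinuousLinearMap.comp_apply, ContinuousLinearMap.coe_fst',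
      ContinuousLinearMap.coe_snd', Complex.ofRealCLM_apply, smul_eq_mul]
    push_cast
    linear_combination (-Complex.exp (-(p.1 : ℂ) * Complex.I)) * Complex.I_sq
  · simp

theorem cos_pos_of_mem {θ : ℝ} (h : θ ∈ Icc (-(Real.pi / 6)) (Real.pi / 6)) : 0 < Real.cos θ :=
  Real.cos_pos_of_mem_Ioo ⟨by linarith [h.1, Real.pi_pos], by linarith [h.2, Real.pi_pos]⟩

theorem arcCoord_im_pos {p : ℝ × ℝ} (h : p.1 ∈ Icc (-(Real.pi / 6)) (Real.pi / 6))
    (ht : 0 ≤ p.2) : 0 < (arcCoord p).im := by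
  rw [arcCoord_im]
  linarith [cos_pos_of_mem h]

theorem arcCoord_pi_div_six (t : ℝ) :
    arcCoord (Real.pi / 6, t) = arcCoord (-(Real.pi / 6), t) + 1 := by
  apply Complex.ext
  · rw [Complex.add_re, arcCoord_re, arcCoord_re]
    simp only [Real.sin_neg, Real.sin_pi_div_six, Complex.one_re]
    norm_num
  · rw [Complex.add_im, arcCoord_im, arcCoord_im]
    simp

/-- On the unit arc the inversion `S` is the reflection `θ ↦ -θ`; this is what folds the bottom edge
onto itself. -/
theorem arcCoord_neg_zero (θ : ℝ) : arcCoord (-θ, 0) = -1 / arcCoord (θ, 0) := by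
  rw [eq_div_iff]
  · simp only [arcCoord, Complex.ofReal_neg, neg_neg, Complex.ofReal_zero, add_zero]
    have : Complex.exp ((θ : ℂ) * Complex.I) * Complex.exp (-(θ : ℂ) * Complex.I) = 1 := by
      rw [← Complex.exp_add]
      simp
    linear_combination Complex.I ^ 2 * this + Complex.I_sq
  · simp [arcCoord, Complex.exp_ne_zero]

theorem norm_arcCoord_zero (θ : ℝ) : ‖arcCoord (θ, 0)‖ = 1 := by
  have := Complex.norm_exp_ofReal_mul_I (-θ)
  push_cast at this
  simpa [arcCoord] using this

/-- The twice Wirtinger derivative `∂/∂x - i ∂/∂y`, as a functional of the real derivative. -/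
def wirt (A : ℂ →L[ℝ] ℂ) : ℂ := A 1 - Complex.I * A Complex.I

/-- Stokes' theorem for the form `U d(conj z)`, invariant under `z ↦ z + 1` and `z ↦ -1 / z`, on
the part of the fundamental domain of `SL₂(ℤ)` which lies below the unit circle translated by
`i T`: only the contribution of the upper edge remains. -/
theorem integral_wirt_fundamental_domain {U : ℂ → ℂ} (hU : ContDiffOn ℝ 1 U {w : ℂ | 0 < w.im})
    (hT : ∀ w : ℂ, 0 < w.im → U (w + 1) = U w)
    (hS : ∀ w : ℂ, 0 < w.im → ‖w‖ = 1 → U (-1 / w) = conj w ^ 2 * U w) {T : ℝ} (h0 : 0 ≤ T) :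
    ∫ θ in -(Real.pi / 6)..Real.pi / 6, ∫ t in (0 : ℝ)..T,
        (Real.cos θ : ℂ) * wirt (fderiv ℝ U (arcCoord (θ, t))) =
      -Complex.I * ∫ θ in -(Real.pi / 6)..Real.pi / 6,
        Complex.exp ((θ : ℂ) * Complex.I) * U (arcCoord (θ, T)) := by
  have hπ : -(Real.pi / 6) ≤ Real.pi / 6 := by linarith [Real.pi_pos]
  have hopen : IsOpen {w : ℂ | 0 < w.im} := isOpen_lt continuous_const Complex.continuous_im
  choose A hA hA1 hA2 using hasFDerivAt_arcCoord
  set R : Set (ℝ × ℝ) := Icc (-(Real.pi / 6)) (Real.pi / 6) ×ˢ Icc 0 T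
  have hmaps : MapsTo arcCoord R {w : ℂ | 0 < w.im} := fun p hp => arcCoord_im_pos hp.1 hp.2.1
  have hcU : ContinuousOn (fun p => U (arcCoord p)) R :=
    hU.continuousOn.comp continuous_arcCoord.continuousOn hmaps
  have hcD : ContinuousOn (fun p => fderiv ℝ U (arcCoord p)) R :=
    (hU.continuousOn_fderiv_of_isOpen hopen le_rfl).comp continuous_arcCoord.continuousOn hmaps
  let e : ℝ × ℝ → ℂ := fun p => Complex.exp ((p.1 : ℂ) * Complex.I)
  have hce : Continuous e := by fun_prop
  have hde : ∀ p, ∃ B : ℝ × ℝ →L[ℝ] ℂ, HasFDerivAt e B p ∧ B (0, 1) = 0 := by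
    intro p
    have h1 : HasFDerivAt (fun p : ℝ × ℝ => (p.1 : ℂ))
        (Complex.ofRealCLM.comp (ContinuousLinearMap.fst ℝ ℝ ℝ)) p :=
      Complex.ofRealCLM.hasFDerivAt.comp p hasFDerivAt_fst
    exact ⟨_, (h1.mul_const Complex.I).cexp, by simp⟩
  choose B hB hB2 using hde
  have hdU : ∀ p ∈ R, HasFDerivAt (fun p => U (arcCoord p))
      ((fderiv ℝ U (arcCoord p)).comp (A p)) p := fun p hp =>
    (((hU.contDiffAt (hopen.mem_nhds (hmaps hp))).differentiableAt one_ne_zero).hasFDerivAt).comp p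
      (hA p)
  -- The pullback of `d(conj z)` is `e dθ - i dt`, so this is the coefficient of `dθ dt` in the
  -- pullback of `d(U d(conj z))`. The factor `cos θ` is the Jacobian of `arcCoord`.
  have key : ∀ p : ℝ × ℝ, ((-Complex.I) • ((fderiv ℝ U (arcCoord p)).comp (A p))) (1, 0) +
      (-(e p • ((fderiv ℝ U (arcCoord p)).comp (A p)) + U (arcCoord p) • B p)) (0, 1) =
      -Complex.I * ((Real.cos p.1 : ℂ) * wirt (fderiv ℝ U (arcCoord p))) := by
    intro p
    set D := fderiv ℝ U (arcCoord p)
    have e1 : Complex.exp (-(p.1 : ℂ) * Complex.I) =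
        (Real.cos p.1) • (1 : ℂ) - (Real.sin p.1) • Complex.I := by
      rw [Complex.exp_mul_I, Complex.cos_neg, Complex.sin_neg]
      simp
      ring
    have hD : D (Complex.exp (-(p.1 : ℂ) * Complex.I)) =
        (Real.cos p.1 : ℂ) * D 1 - (Real.sin p.1 : ℂ) * D Complex.I := by
      rw [e1, map_sub, map_smul, map_smul, Complex.real_smul, Complex.real_smul]
    have e2 : e p = (Real.cos p.1 : ℂ) + (Real.sin p.1 : ℂ) * Complex.I := by
      simp only [e]
      rw [Complex.exp_mul_I]
      simp
    simp only [smul_apply, add_apply,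
      neg_apply, ContinuousLinearMap.comp_apply, hA1, hA2, hB2, smul_eq_mul,
      mul_zero, add_zero, e2, hD, wirt]
    linear_combination (-(Real.cos p.1 : ℂ) * D Complex.I) * Complex.I_sq
  have main := integral2_divergence_prod_of_hasFDerivAt_off_countable
    (fun p => -Complex.I * U (arcCoord p)) (fun p => -(e p * U (arcCoord p)))
    (fun p => (-Complex.I) • ((fderiv ℝ U (arcCoord p)).comp (A p)))
    (fun p => -(e p • ((fderiv ℝ U (arcCoord p)).comp (A p)) + U (arcCoord p) • B p))
    (-(Real.pi / 6)) 0 (Real.pi / 6) T ∅ countable_empty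
    (by rw [uIcc_of_le hπ, uIcc_of_le h0]; exact continuousOn_const.mul hcU)
    (by rw [uIcc_of_le hπ, uIcc_of_le h0]; exact (hce.continuousOn.mul hcU).neg)
    (by
      rw [min_eq_left hπ, max_eq_right hπ, min_eq_left h0, max_eq_right h0]
      exact fun p hp => (hdU p ⟨Ioo_subset_Icc_self hp.1.1, Ioo_subset_Icc_self hp.1.2⟩).const_mul _)
    (by
      rw [min_eq_left hπ, max_eq_right hπ, min_eq_left h0, max_eq_right h0]
      exact fun p hp => ((hB p).mul
        (hdU p ⟨Ioo_subset_Icc_self hp.1.1, Ioo_subset_Icc_self hp.1.2⟩)).neg)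
    (by
      rw [uIcc_of_le hπ, uIcc_of_le h0]
      simp_rw [key]
      refine ContinuousOn.integrableOn_compact (isCompact_Icc.prod isCompact_Icc) ?_
      refine continuousOn_const.mul (ContinuousOn.mul (by fun_prop) ?_)
      exact (hcD.clm_apply continuousOn_const).sub
        (continuousOn_const.mul (hcD.clm_apply continuousOn_const)))
  simp_rw [key] at main
  have hside : ∫ t in (0 : ℝ)..T, -Complex.I * U (arcCoord (Real.pi / 6, t)) =
      ∫ t in (0 : ℝ)..T, -Complex.I * U (arcCoord (-(Real.pi / 6), t)) := by
    refine intervalIntegral.integral_congr fun t ht => ?_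
    rw [uIcc_of_le h0] at ht
    rw [arcCoord_pi_div_six, hT _ (arcCoord_im_pos ⟨le_rfl, hπ⟩ ht.1)]
  -- Invariance under `S` makes the integrand odd in `θ`.
  have hbot : ∫ θ in -(Real.pi / 6)..Real.pi / 6, -(e (θ, 0) * U (arcCoord (θ, 0))) = 0 := by
    have h := intervalIntegral.integral_comp_neg (a := -(Real.pi / 6)) (b := Real.pi / 6)
      (fun θ : ℝ => -(e (θ, 0) * U (arcCoord (θ, 0))))
    rw [neg_neg] at h
    have h' : ∫ θ in -(Real.pi / 6)..Real.pi / 6, -(e (-θ, 0) * U (arcCoord (-θ, 0))) =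
        ∫ θ in -(Real.pi / 6)..Real.pi / 6, -(-(e (θ, 0) * U (arcCoord (θ, 0)))) := by
      refine intervalIntegral.integral_congr fun θ hθ => ?_
      rw [uIcc_of_le hπ] at hθ
      rw [arcCoord_neg_zero, hS _ (arcCoord_im_pos hθ le_rfl) (norm_arcCoord_zero θ)]
      have e3 : conj (arcCoord (θ, 0)) = -Complex.I * e (θ, 0) := by
        simp [arcCoord, e, ← Complex.exp_conj]
      have e4 : e (-θ, 0) * e (θ, 0) = 1 := by
        simp only [e]
        rw [← Complex.exp_add]
        simp
      rw [e3]
      linear_combination (-(e (-θ, 0) * e (θ, 0) ^ 2 * U (arcCoord (θ, 0)))) * Complex.I_sq +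
        (e (θ, 0) * U (arcCoord (θ, 0))) * e4
    rw [h', intervalIntegral.integral_neg] at h
    exact self_eq_neg.mp h.symm
  rw [hside, hbot] at main
  simp only [intervalIntegral.integral_const_mul, intervalIntegral.integral_neg] at main
  simp only [intervalIntegral.integral_const_mul]
  simp only [e] at main
  linear_combination Complex.I * main + (∫ θ in -(Real.pi / 6)..Real.pi / 6, (Real.cos θ : ℂ) * ∫ t in (0 : ℝ)..T,
        wirt (fderiv ℝ U (arcCoord (θ, t)))) * Complex.I_sq

/-! ### Modularity and growth at the cusp -/

theorem isModular_add_one {r s : ℤ} {F : ℍ → ℂ} (hF : IsModularOfWeights r s F) (z : ℍ) :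
    F ((1 : ℝ) +ᵥ z) = F z := by
  have h := hF ModularGroup.T z
  rw [modular_T_smul] at h
  simpa [ModularGroup.T] using h

theorem isModular_S {r s : ℤ} {F : ℍ → ℂ} (hF : IsModularOfWeights r s F) (z : ℍ) :
    F (ModularGroup.S • z) = (z : ℂ) ^ r * conj (z : ℂ) ^ s * F z := by
  have h := hF ModularGroup.S z
  simpa [ModularGroup.S] using h

theorem cuspForm_isModular {n : ℤ} (f : CuspForm 𝒮ℒ n) : IsModularOfWeights n 0 f := by
  intro γ z
  have h := SlashInvariantForm.slash_action_eqn' f (γ := Matrix.SpecialLinearGroup.mapGL ℝ γ)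
    (MonoidHom.mem_range.mpr ⟨γ, rfl⟩) z
  have e : γ • z = Matrix.SpecialLinearGroup.mapGL ℝ γ • z := rfl
  rw [e, h]
  simp

/-- A function with an expansion at the cusp grows at most polynomially in `y`. -/
theorem HasExpansion.isBigO {f : ℍ → ℂ} (hf : HasExpansion f) :
    ∃ N : ℕ, f =O[atImInfty] fun z => z.im ^ N := by
  obtain ⟨N, a, Y, h⟩ := hf
  refine ⟨N, ?_⟩
  let z₀ : ℍ := ⟨Complex.I * ((max Y 0 + 1 : ℝ) : ℂ), by simp; positivity⟩
  have hz₀ : z₀.im = max Y 0 + 1 := by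
    change (Complex.I * ((max Y 0 + 1 : ℝ) : ℂ)).im = _
    simp
  have hY : Y < z₀.im := by rw [hz₀]; linarith [le_max_left Y 0]
  have hev : ∀ᶠ z : ℍ in atImInfty, max z₀.im 1 ≤ z.im := by
    rw [Filter.Eventually, atImInfty_mem]
    exact ⟨_, fun z hz => hz⟩
  have hnq : ∀ z : ℍ, ‖q z‖ = Real.exp (-2 * Real.pi * z.im) := by
    intro z
    rw [q, Complex.norm_exp]
    simp
  have hfe : f =ᶠ[atImInfty] fun z =>
      ∑ k ∈ Finset.Icc (-N : ℤ) N, L z ^ k * ∑' p : ℕ × ℕ, expTerm (a k) z p := by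
    filter_upwards [hev] with z hz
    exact (h z (hY.trans_le ((le_max_left _ _).trans hz))).2
  refine hfe.trans_isBigO (Asymptotics.IsBigO.fun_sum fun k hk => ?_)
  have hb1 : (fun z : ℍ => L z ^ k) =O[atImInfty] fun z : ℍ => z.im ^ N := by
    refine Asymptotics.IsBigO.of_bound ((2 * Real.pi) ^ k) ?_
    filter_upwards [hev] with z hz
    have h1 : 1 ≤ z.im := (le_max_right _ _).trans hz
    have hL : ‖L z‖ = 2 * Real.pi * z.im := by
      rw [L, Complex.norm_real, Real.norm_eq_abs, abs_of_nonpos]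
      · ring
      · nlinarith [Real.pi_pos]
    rw [norm_zpow, hL, mul_zpow, norm_pow, Real.norm_of_nonneg (by linarith), ← zpow_natCast]
    gcongr
    exact (Finset.mem_Icc.mp hk).2
  have hb2 : (fun z : ℍ => ∑' p : ℕ × ℕ, expTerm (a k) z p) =O[atImInfty] fun _ => (1 : ℝ) := by
    -- `|q|` decreases with `y`, so the absolutely convergent series at `z₀` dominates termwise all
    -- series higher up.
    refine Asymptotics.IsBigO.of_bound (∑' p : ℕ × ℕ, ‖expTerm (a k) z₀ p‖) ?_
    filter_upwards [hev] with z hz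
    have hs := ((h z₀ hY).1 k hk).norm
    simp only [norm_one, mul_one]
    refine tsum_of_norm_bounded hs.hasSum fun p => ?_
    have hq : ‖q z‖ ≤ ‖q z₀‖ := by
      rw [hnq, hnq, Real.exp_le_exp]
      have := (le_max_left _ _).trans hz
      nlinarith [Real.pi_pos]
    simp only [expTerm, norm_mul, norm_pow, RCLike.norm_conj]
    gcongr
  simpa using hb1.mul hb2

/-! ### The invariant form and its derivative -/

/-- The function `y ^ r F conj f` on `ℂ`. -/
def pairing (r : ℤ) (F f : ℍ → ℂ) (w : ℂ) : ℂ :=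
  (w.im : ℂ) ^ r * F (ofComplex w) * conj (f (ofComplex w))

theorem pairing_coe (r : ℤ) (F f : ℍ → ℂ) (z : ℍ) :
    pairing r F f (z : ℂ) = (z.im : ℂ) ^ r * F z * conj (f z) := by
  rw [pairing, ofComplex_apply, coe_im]

theorem pairing_tendsto_zero {n r : ℤ} {F : ℍ → ℂ} (hF : HasExpansion F) (f : CuspForm 𝒮ℒ n) :
    Tendsto (fun z : ℍ => pairing r F f z) atImInfty (𝓝 0) := by
  obtain ⟨N, hN⟩ := hF.isBigO
  have hc := CuspFormClass.exp_decay_atImInfty (h := 1) f one_pos one_mem_strictPeriods_SL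
  have h1 : (fun z : ℍ => pairing r F f z) =O[atImInfty]
      fun z : ℍ => (z.im ^ r * z.im ^ N) * Real.exp (-2 * Real.pi * z.im / 1) := by
    simp only [pairing_coe]
    refine ((Asymptotics.isBigO_of_le _ fun z => ?_).mul hN).mul
      ((Asymptotics.isBigO_of_le _ fun z => ?_).trans hc)
    · simp
    · simp
  refine h1.trans_tendsto ?_
  have h2 : Tendsto (fun y : ℝ => y ^ r * y ^ N * Real.exp (-2 * Real.pi * y / 1)) atTop (𝓝 0) := by
    have h3 := (isLittleO_zpow_exp_pos_mul_atTop (r + N) Real.two_pi_pos).tendsto_div_nhds_zero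
    refine h3.congr' ?_
    filter_upwards [eventually_gt_atTop 0] with y hy
    rw [zpow_add₀ hy.ne', zpow_natCast, div_eq_mul_inv, ← Real.exp_neg]
    congr 2
    ring
  exact h2.comp tendsto_comap

theorem pairing_add_one {r s n : ℤ} {F f : ℍ → ℂ} (hF : IsModularOfWeights r s F)
    (hf : IsModularOfWeights n 0 f) {w : ℂ} (hw : 0 < w.im) :
    pairing r F f (w + 1) = pairing r F f w := by
  lift w to ℍ using hw
  have : (w : ℂ) + 1 = (((1 : ℝ) +ᵥ w : ℍ) : ℂ) := by
    rw [coe_vadd, add_comm]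
    simp
  rw [this, pairing_coe, pairing_coe, isModular_add_one hF, isModular_add_one hf]
  simp

/-- On the unit circle `S` preserves `y` and `w = (conj w)⁻¹`, so all automorphy factors combine
into `conj w ^ (-r + s + n)`, whose exponent is 2. -/
theorem pairing_S {r s n : ℤ} {F f : ℍ → ℂ} (hF : IsModularOfWeights r s F)
    (hf : IsModularOfWeights n 0 f) (hn : s + n = r + 2) {w : ℂ} (hw : 0 < w.im) (h1 : ‖w‖ = 1) :
    pairing r F f (-1 / w) = conj w ^ 2 * pairing r F f w := by
  lift w to ℍ using hw
  have hS : (-1 / (w : ℂ)) = ((ModularGroup.S • w : ℍ) : ℂ) := by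
    rw [modular_S_smul]
    change _ = (-(w : ℂ))⁻¹
    rw [inv_neg, neg_div, one_div]
  have hne : (w : ℂ) ≠ 0 := w.ne_zero
  have hcne : conj (w : ℂ) ≠ 0 := by simpa using hne
  have hinv : (w : ℂ)⁻¹ = conj (w : ℂ) := Complex.inv_eq_conj h1
  have him : (ModularGroup.S • w : ℍ).im = w.im := by
    rw [← coe_im, ← hS, neg_div, one_div, hinv]
    simp
  have hw' : (w : ℂ) = (conj (w : ℂ))⁻¹ := by rw [← hinv, inv_inv]
  rw [hS, pairing_coe, pairing_coe, isModular_S hF, isModular_S hf, him]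
  simp only [map_mul, map_zpow₀, zpow_zero, mul_one]
  have : (w : ℂ) ^ r * conj (w : ℂ) ^ s * conj (w : ℂ) ^ n = conj (w : ℂ) ^ 2 := by
    have : (w : ℂ) ^ r = conj (w : ℂ) ^ (-r) := by rw [zpow_neg, ← inv_zpow, ← hw']
    rw [this, ← zpow_add₀ hcne, ← zpow_add₀ hcne, show -r + s + n = ((2 : ℕ) : ℤ) by
      push_cast; omega, zpow_natCast]
  linear_combination ((w.im : ℂ) ^ r * F w * conj (f w)) * this

theorem differentiableOn_comp_ofComplex {n : ℤ} (f : CuspForm 𝒮ℒ n) :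
    DifferentiableOn ℂ (fun w : ℂ => f (ofComplex w)) {w : ℂ | 0 < w.im} :=
  mdifferentiable_iff.mp (CuspFormClass.holo f)

theorem hasFDerivAt_im_zpow (r : ℤ) {w : ℂ} (hw : 0 < w.im) :
    ∃ A : ℂ →L[ℝ] ℂ, HasFDerivAt (fun w : ℂ => (w.im : ℂ) ^ r) A w ∧
      A 1 = 0 ∧ A Complex.I = (r : ℂ) * (w.im : ℂ) ^ (r - 1) := by
  have h1 : HasFDerivAt (fun w : ℂ => (w.im : ℂ)) (Complex.ofRealCLM.comp Complex.imCLM) w :=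
    Complex.ofRealCLM.hasFDerivAt.comp w Complex.imCLM.hasFDerivAt
  have h2 := hasDerivAt_zpow r (w.im : ℂ) (Or.inl (Complex.ofReal_ne_zero.mpr hw.ne'))
  refine ⟨_, HasFDerivAt.comp (g := fun x : ℂ => x ^ r) w h2.complexToReal_fderiv h1, ?_, ?_⟩
  · simp
  · simp

theorem hasFDerivAt_conj_holomorphic {g : ℂ → ℂ} {w : ℂ} (hg : DifferentiableAt ℂ g w) :
    ∃ A : ℂ →L[ℝ] ℂ, HasFDerivAt (fun w => conj (g w)) A w ∧ wirt A = 0 := by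
  refine ⟨_, Complex.conjCLE.hasFDerivAt.comp w hg.hasDerivAt.complexToReal_fderiv, ?_⟩
  simp only [wirt]
  simp
  linear_combination conj (deriv g w) * Complex.I_sq

theorem contDiffOn_pairing {n r : ℤ} {F : ℍ → ℂ} (hF : IsRealAnalytic F) (f : CuspForm 𝒮ℒ n) :
    ContDiffOn ℝ 1 (pairing r F f) {w : ℂ | 0 < w.im} := by
  have hopen : IsOpen {w : ℂ | 0 < w.im} := isOpen_lt continuous_const Complex.continuous_im
  have h1 : ContDiffOn ℝ 1 (fun w : ℂ => (w.im : ℂ) ^ r) {w : ℂ | 0 < w.im} := fun w hw => by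
    have h : AnalyticAt ℝ (fun w : ℂ => (w.im : ℂ)) w :=
      (Complex.ofRealCLM.comp Complex.imCLM).analyticAt w
    exact ((h.zpow (n := r) (Complex.ofReal_ne_zero.mpr (ne_of_gt hw))).contDiffAt).contDiffWithinAt
  have h2 : ContDiffOn ℝ 1 (fun w : ℂ => F (ofComplex w)) {w : ℂ | 0 < w.im} :=
    fun w hw => (hF w hw).contDiffAt.contDiffWithinAt
  have h3 : ContDiffOn ℝ 1 (fun w : ℂ => conj (f (ofComplex w))) {w : ℂ | 0 < w.im} :=
    Complex.conjCLE.contDiff.comp_contDiffOn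
      (((differentiableOn_comp_ofComplex f).contDiffOn hopen).restrict_scalars ℝ)
  exact (h1.mul h2).mul h3

/-- The factor `y ^ r` is an integrating factor: its derivative supplies the term `r` of `∂_r`, and
`z - conj z = 2 i y` accounts for the exponent `r - 1`. The factor `conj f` is a constant for
`∂/∂z`. -/
theorem wirt_fderiv_pairing {n r : ℤ} {F : ℍ → ℂ} (hF : IsRealAnalytic F) (f : CuspForm 𝒮ℒ n)
    (z : ℍ) : wirt (fderiv ℝ (pairing r F f) (z : ℂ)) =
      -Complex.I * (z.im : ℂ) ^ (r - 1) * partialOp r F z * conj (f z) := by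
  have hopen : IsOpen {w : ℂ | 0 < w.im} := isOpen_lt continuous_const Complex.continuous_im
  obtain ⟨A, hA, hA1, hAI⟩ := hasFDerivAt_im_zpow r z.im_pos
  obtain ⟨C, hC, hC0⟩ := hasFDerivAt_conj_holomorphic
    ((differentiableOn_comp_ofComplex f).differentiableAt (hopen.mem_nhds z.im_pos))
  have hB := (hF z z.im_pos).differentiableAt.hasFDerivAt
  have h : HasFDerivAt (pairing r F f) _ (z : ℂ) := (hA.mul hB).mul hC
  rw [h.fderiv]
  rw [partialOp, wirtinger]
  set B := fderiv ℝ (fun w : ℂ => F (ofComplex w)) (z : ℂ)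
  have hy : (z.im : ℂ) ≠ 0 := Complex.ofReal_ne_zero.mpr z.im_pos.ne'
  have hzz : (z : ℂ) - conj (z : ℂ) = 2 * Complex.I * (z.im : ℂ) := by
    rw [Complex.sub_conj, coe_im]
    push_cast
    ring
  simp only [wirt] at hC0
  simp only [wirt, smul_apply, add_apply, Pi.mul_apply, smul_eq_mul, hA1, hAI, hzz, ofComplex_apply, coe_im]
  rw [zpow_sub_one₀ hy]
  field_simp
  linear_combination ((z.im : ℂ) ^ r * (z.im : ℂ) * F z) * hC0 +
    (B 1 - Complex.I * B Complex.I) * (z.im : ℂ) * (z.im : ℂ) ^ r * conj (f z) * Complex.I_sq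

/-! ### Positivity of the norm -/

/-- The density `y ^ m |f| ^ 2 dx dy` in the coordinates `arcCoord`. -/
def normDensity (m : ℤ) (f : ℍ → ℂ) (p : ℝ × ℝ) : ℝ :=
  Real.cos p.1 * ((arcCoord p).im ^ m * ‖f (ofComplex (arcCoord p))‖ ^ 2)

/-- The coordinate rectangle on which `arcCoord` parametrises the strip of height `T`. -/
def arcRect (T : ℝ) : Set (ℝ × ℝ) := Icc (-(Real.pi / 6)) (Real.pi / 6) ×ˢ Icc 0 T

theorem normDensity_nonneg (m : ℤ) (f : ℍ → ℂ) {T : ℝ} {p : ℝ × ℝ} (hp : p ∈ arcRect T) :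
    0 ≤ normDensity m f p := by
  have := arcCoord_im_pos hp.1 hp.2.1
  have := cos_pos_of_mem hp.1
  unfold normDensity
  positivity

theorem continuousOn_normDensity (m : ℤ) {n : ℤ} (f : CuspForm 𝒮ℒ n) (T : ℝ) :
    ContinuousOn (normDensity m f) (arcRect T) := by
  have hmaps : MapsTo arcCoord (arcRect T) {w : ℂ | 0 < w.im} :=
    fun p hp => arcCoord_im_pos hp.1 hp.2.1
  refine ContinuousOn.mul (by fun_prop) (ContinuousOn.mul ?_ ?_)
  · exact (Complex.continuous_im.comp continuous_arcCoord).continuousOn.zpow₀ m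
      fun p hp => Or.inl (hmaps hp).ne'
  · exact (((differentiableOn_comp_ofComplex f).continuousOn.comp
      continuous_arcCoord.continuousOn hmaps).norm).pow 2

theorem integrableOn_normDensity (m : ℤ) {n : ℤ} (f : CuspForm 𝒮ℒ n) (T : ℝ) :
    IntegrableOn (normDensity m f) (arcRect T) :=
  (continuousOn_normDensity m f T).integrableOn_compact (isCompact_Icc.prod isCompact_Icc)

theorem integral_normDensity_eq (m : ℤ) {n : ℤ} (f : CuspForm 𝒮ℒ n) {T : ℝ} (hT : 0 ≤ T) :
    ∫ θ in -(Real.pi / 6)..Real.pi / 6, ∫ t in (0 : ℝ)..T, normDensity m f (θ, t) =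
      ∫ p in arcRect T, normDensity m f p := by
  have hπ : -(Real.pi / 6) ≤ Real.pi / 6 := by linarith [Real.pi_pos]
  rw [arcRect, Measure.volume_eq_prod, setIntegral_prod _ (integrableOn_normDensity m f T),
    intervalIntegral.integral_of_le hπ, integral_Icc_eq_integral_Ioc]
  simp_rw [intervalIntegral.integral_of_le hT, integral_Icc_eq_integral_Ioc]

/-- The integral of `y ^ m |f| ^ 2` over the lowest part of the strip is positive. -/
theorem integral_normDensity_pos (m : ℤ) {n : ℤ} {f : CuspForm 𝒮ℒ n} (hf : f ≠ 0) :
    0 < ∫ p in arcRect 1, normDensity m f p := by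
  have hmeas : MeasurableSet (arcRect 1) := measurableSet_Icc.prod measurableSet_Icc
  have hnn : 0 ≤ᵐ[volume.restrict (arcRect 1)] normDensity m f :=
    (ae_restrict_iff' hmeas).mpr (ae_of_all _ fun p hp => normDensity_nonneg m f hp)
  refine lt_of_le_of_ne (integral_nonneg_of_ae hnn) fun h0 => hf ?_
  have hae := (setIntegral_eq_zero_iff_of_nonneg_ae hnn (integrableOn_normDensity m f 1)).mp h0.symm
  have hzero : EqOn (normDensity m f) 0 (arcRect 1) := by
    refine Measure.eqOn_of_ae_eq hae (continuousOn_normDensity m f 1) continuousOn_const ?_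
    rw [arcRect, interior_prod_eq, closure_prod_eq, interior_Icc, interior_Icc,
      closure_Ioo (by linarith [Real.pi_pos]), closure_Ioo zero_ne_one]
  -- A zero integral forces `f` to vanish on the segment from `i` to `2i`, whose points accumulate
  -- at `i`; the identity theorem then gives `f = 0`.
  have hvan : ∀ t ∈ Icc (0 : ℝ) 1, f (ofComplex (arcCoord (0, t))) = 0 := by
    intro t ht
    have hmem : ((0 : ℝ), t) ∈ arcRect 1 :=
      ⟨⟨by linarith [Real.pi_pos], by positivity⟩, ht⟩
    have h := hzero hmem
    have hy := arcCoord_im_pos hmem.1 hmem.2.1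
    have hc := cos_pos_of_mem hmem.1
    simpa [normDensity, hc.ne', zpow_ne_zero, hy.ne'] using h
  have hana := (differentiableOn_comp_ofComplex f).analyticOnNhd isOpen_upperHalfPlaneSet
  have hI : arcCoord (0, 0) = Complex.I := by simp [arcCoord]
  have hfreq : ∃ᶠ w in 𝓝[≠] Complex.I, f (ofComplex w) = 0 := by
    have htend : Tendsto (fun t : ℝ => arcCoord (0, t)) (𝓝[>] 0) (𝓝[≠] Complex.I) := by
      refine tendsto_nhdsWithin_iff.mpr ⟨?_, ?_⟩
      · rw [← hI]
        exact ((continuous_arcCoord.comp (by fun_prop : Continuous fun t : ℝ => ((0 : ℝ), t))).tendsto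
          0).mono_left nhdsWithin_le_nhds
      · filter_upwards [self_mem_nhdsWithin] with t ht h
        have := congrArg Complex.im h
        rw [arcCoord_im] at this
        simp only [Real.cos_zero, Complex.I_im] at this
        exact (ne_of_gt (mem_Ioi.mp ht)) (by linarith)
    refine htend.frequently (Eventually.frequently ?_)
    filter_upwards [Ioc_mem_nhdsGT zero_lt_one] with t ht
    exact hvan t ⟨ht.1.le, ht.2⟩
  have heq := hana.eqOn_zero_of_preconnected_of_frequently_eq_zero
    (Complex.isConnected_of_upperHalfPlane subset_rfl (by grind)).isPreconnected
    (by simp) hfreq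
  ext z
  simpa using heq z.im_pos

/-! ### The contradiction -/

/-- The norm of `f` on the strip of height `T` is an integral over its upper edge, if `f` times a
power of `𝕃` is in the image of `∂`. -/
theorem integral_normDensity_eq_edge {n k r s : ℤ} {f : CuspForm 𝒮ℒ n} {F : ℍ → ℂ}
    (hF : IsRealAnalytic F) (hmod : IsModularOfWeights r s F) (hrs : s + n = r + 2)
    (h : ∀ z, partialOp r F z = L z ^ k * f z) {T : ℝ} (hT : 0 ≤ T) :
    (-2 * Real.pi : ℂ) ^ k * ((∫ p in arcRect T, normDensity (r - 1 + k) f p : ℝ) : ℂ) =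
      ∫ θ in -(Real.pi / 6)..Real.pi / 6,
        Complex.exp ((θ : ℂ) * Complex.I) * pairing r F f (arcCoord (θ, T)) := by
  have hπ : -(Real.pi / 6) ≤ Real.pi / 6 := by linarith [Real.pi_pos]
  have hgreen := integral_wirt_fundamental_domain (contDiffOn_pairing (r := r) hF f)
    (fun w hw => pairing_add_one hmod (cuspForm_isModular f) hw)
    (fun w hw h1 => pairing_S hmod (cuspForm_isModular f) hrs hw h1) hT
  have hint : ∫ θ in -(Real.pi / 6)..Real.pi / 6, ∫ t in (0 : ℝ)..T,
      (Real.cos θ : ℂ) * wirt (fderiv ℝ (pairing r F f) (arcCoord (θ, t))) =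
      ∫ θ in -(Real.pi / 6)..Real.pi / 6, ∫ t in (0 : ℝ)..T,
        (-Complex.I * (-2 * Real.pi : ℂ) ^ k) * (normDensity (r - 1 + k) f (θ, t) : ℂ) := by
    refine intervalIntegral.integral_congr fun θ hθ => intervalIntegral.integral_congr fun t ht => ?_
    rw [uIcc_of_le hπ] at hθ
    rw [uIcc_of_le hT] at ht
    have hy := arcCoord_im_pos (p := (θ, t)) hθ ht.1
    simp only [normDensity]
    generalize arcCoord (θ, t) = w at hy
    lift w to ℍ using hy
    rw [wirt_fderiv_pairing hF f w, h, ofComplex_apply, coe_im]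
    have hyc : (w.im : ℂ) ≠ 0 := Complex.ofReal_ne_zero.mpr w.im_pos.ne'
    have hL : L w = (-2 * Real.pi : ℂ) * (w.im : ℂ) := by
      rw [L]
      push_cast
      ring
    rw [hL, mul_zpow]
    push_cast
    rw [zpow_add₀ hyc (r - 1) k, ← Complex.mul_conj']
    ring
  rw [hint] at hgreen
  simp only [intervalIntegral.integral_const_mul, intervalIntegral.integral_ofReal] at hgreen
  rw [integral_normDensity_eq _ f hT] at hgreen
  have hI : -Complex.I ≠ 0 := neg_ne_zero.mpr Complex.I_ne_zero
  exact mul_left_cancel₀ hI (by rw [← mul_assoc]; exact hgreen)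

theorem partialOp_ne_zpow_mul_cuspForm {n k r s : ℤ} {f : CuspForm 𝒮ℒ n} (hf : f ≠ 0) {F : ℍ → ℂ}
    (hF : F ∈ Mrs r s) (hrs : s + n = r + 2) :
    ¬ ∀ z, partialOp r F z = L z ^ k * f z := by
  intro h
  obtain ⟨han, hmod, hexp⟩ := hF
  set c := ∫ p in arcRect 1, normDensity (r - 1 + k) f p
  have hcpos : 0 < c := integral_normDensity_pos _ hf
  -- The `θ`-interval has length `π / 3`, so a bound `ε` on the pairing makes the edge integral at
  -- most half of `(2π) ^ k c`, which it should dominate.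
  set ε := (2 * Real.pi) ^ k * c / (2 * Real.pi / 3) with hε
  have hεpos : 0 < ε := by have := Real.pi_pos; positivity
  have hev := (pairing_tendsto_zero (r := r) hexp f).eventually (Metric.closedBall_mem_nhds 0 hεpos)
  rw [Filter.Eventually, atImInfty_mem] at hev
  obtain ⟨B, hB⟩ := hev
  set T := max B 1
  have hT1 : 1 ≤ T := le_max_right _ _
  have hπ : -(Real.pi / 6) ≤ Real.pi / 6 := by linarith [Real.pi_pos]
  have hedge := integral_normDensity_eq_edge han hmod hrs h (zero_le_one.trans hT1)
  have hbound : ‖∫ θ in -(Real.pi / 6)..Real.pi / 6,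
      Complex.exp ((θ : ℂ) * Complex.I) * pairing r F f (arcCoord (θ, T))‖ ≤
      ε * |Real.pi / 6 - -(Real.pi / 6)| := by
    refine intervalIntegral.norm_integral_le_of_norm_le_const fun θ hθ => ?_
    rw [uIoc_of_le hπ] at hθ
    have hθ' : θ ∈ Icc (-(Real.pi / 6)) (Real.pi / 6) := Ioc_subset_Icc_self hθ
    have hy := arcCoord_im_pos (p := (θ, T)) hθ' (zero_le_one.trans hT1)
    rw [norm_mul, Complex.norm_exp_ofReal_mul_I, one_mul]
    have := hB ⟨arcCoord (θ, T), hy⟩ (by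
      change B ≤ (arcCoord (θ, T)).im
      rw [arcCoord_im]
      linarith [le_max_left B 1, cos_pos_of_mem hθ'])
    simpa using this
  rw [← hedge, norm_mul, norm_zpow, Complex.norm_real, Real.norm_eq_abs] at hbound
  have hn : ‖(-2 * Real.pi : ℂ)‖ = 2 * Real.pi := by
    simp [abs_of_pos Real.pi_pos]
  have hmono : c ≤ ∫ p in arcRect T, normDensity (r - 1 + k) f p := by
    refine setIntegral_mono_set (integrableOn_normDensity _ f T) ?_ ?_
    · exact (ae_restrict_iff' (measurableSet_Icc.prod measurableSet_Icc)).mpr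
        (ae_of_all _ fun p hp => normDensity_nonneg _ f hp)
    · exact (prod_mono le_rfl (Icc_subset_Icc_right hT1)).eventuallyLE
  have hw : |Real.pi / 6 - -(Real.pi / 6)| = Real.pi / 3 := by
    rw [abs_of_nonneg] <;> linarith [Real.pi_pos]
  rw [hn, hw] at hbound
  have h2 : (2 * Real.pi) ^ k * c ≤ ε * (Real.pi / 3) :=
    (mul_le_mul_of_nonneg_left (hmono.trans (le_abs_self _)) (by positivity)).trans hbound
  have h3 : (2 * Real.pi) ^ k * c = 2 * (ε * (Real.pi / 3)) := by
    rw [hε]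
    field_simp
  have h4 : 0 < ε * (Real.pi / 3) := by have := Real.pi_pos; positivity
  linarith

end RealAnalyticModular

end

theorem mainTheorem2 (n : ℤ) (f : CuspForm 𝒮ℒ n) (hf : f ≠ 0) (k : ℤ) :
    ¬ ∃ F : RealAnalyticModular.M,
      RealAnalyticModular.del F = RealAnalyticModular.LpowMul k n f := by
  rintro ⟨F, hF⟩
  -- As `∂` has bidegree `(1, -1)`, only this component of `F` maps to weights `(n - k, -k)`.
  refine RealAnalyticModular.partialOp_ne_zpow_mul_cuspForm (k := k) hf
    (F (n - k - 1, -k + 1)).2 (by simp only; ring) fun z => ?_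
  have h := congrFun (congrFun hF (n - k, -k)) z
  simpa [RealAnalyticModular.del, RealAnalyticModular.LpowMul] using h
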